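/- Let $k$ be an integer with $2k+1\ge 5$, let $T=\begin{bmatrix}0&-1\\1&2k+1\end{bmatrix}\in SL(2,\mathbb Z)$, and let $G=\mathbb Z^2\rtimes\langle t\rangle$, where $t$ has infinite order and $t\,x\,t^{-1}=Tx$ for $x\in\mathbb Z^2$. Elements of $G$ are written $(x,t^n)$. Put $a=(1,0)$, $b=(0,1)$, and let $\|g\|$ be the word length of $g\in G$ with respect to $S=\{a,b,t\}$. **Representatives.** A Laurent polynomial $F(X)=\sum_j c_jX^j\in\mathbb Z[X,X^{-1}]$ represents $x\in\mathbb Z^2$ if $x=F(T)(b)$. For $n\in\mathbb Z$ let $q\ge\max\{0,n\}$ and $p\ge\max\{0,-n\}$ be the least integers such that $c_j=0$ for all $j>q$ and all $j<-p-1$. The $n$-length of $F$ is $L_n(F)=2p+2q-|n|+\sum_j|c_j|$. If $F$ represents $x$ and $L_n(F)=\|(x,t^n)\|$, then $F$ is an $n$-minimal representative of $x$. The polynomial part of $F$ is $\sum_{j\ge0}c_jX^j$ and its principal part is $\sum_{j<0}c_jX^j$. **Reduced polynomials.** Put $\operatorname{sign}^+(y)=1$ for $y\ge0$ and $\operatorname{sign}^+(y)=-1$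 for $y<0$, and let $\operatorname{Pot}(d_1,\dots,d_r)=\sum_{s=1}^r\big((2k-1)-2|d_s|\big)$. Let $P=\sum_{i=0}^m c_iX^i\in\mathbb Z[X]$ have degree $m$ (with $m=0$ if $P=0$), and put $c_i=0$ for $i<0$ and for $i>m$. $P$ is $n$-reduced if the following rules hold. 1. If $m\ge n$, then $|c_m|\le k+2$, and $|c_m|\le k+1$ if $c_mc_{m-1}<0$. 2. For every $i\ge 0$ with $i=m<n$ or $i<m$: $|c_i|\le k+1$; $|c_i|\le k$ if $c_{i+1}c_i<0$ or $c_ic_{i-1}<0$; $|c_i|\le k-1$ if $c_{i+1}c_i<0$ and $c_ic_{i-1}<0$. 3. If $m>n$ and $m\ge1$, then $(c_m,c_{m-1})\ne\pm(1,-k)$, and $(c_m,c_{m-1})\neq\pm(1,-k+1)$ if $c_{m-1}c_{m-2}<0$. 4. If $m>n$, $1\le i\le m$, and $(c_m,\dots,c_{m-i})=\pm(1,c'_{m-1},\dots,c'_{m-i})$ with $c'_{m-1}\in\{-k+1,-k+2\}$, $c'_{m-j}\in\{-k+1,-k\}$ for $1<j<i$, and $c'_{m-i}\in\{-k,-k-1\}$,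 then $\operatorname{Pot}(c'_{m-1},\dots,c'_{m-i})\ge2$ if $c_mc_{m-i-1}>0$, and $\operatorname{Pot}(c'_{m-1},\dots,c'_{m-i})>0$ if $c_mc_{m-i-1}\le0$. 5. If $m\ge n$, $1\le i\le m$, and $(c_m,\dots,c_{m-i})=\pm(c'_m,\dots,c'_{m-i})$ with $c'_m\in\{k+1,k+2\}$, $c'_{m-j}\in\{k-1,k\}$ for $0<j<i$, and $c'_{m-i}\in\{k,k+1\}$, then $\operatorname{Pot}(c'_m,\dots,c'_{m-i})>-6$ if $c_mc_{m-i-1}\ge0$, and $\operatorname{Pot}(c'_m,\dots,c'_{m-i})\ge-4$ if $c_mc_{m-i-1}<0$. 6. If $0\le l<j$, either $0<j<m$ or $0<j=m<n$, and $(c_j,\dots,c_l)=\pm(c'_j,\dots,c'_l)$ with $c'_j,c'_l\in\{k,k+1\}$ and $c'_s\in\{k-1,k\}$ for $l<s<j$, then $\operatorname{Pot}(c_j,\dots,c_l)>-3-\operatorname{sign}^+(c_jc_{j+1})$ if $c_jc_{l-1}\ge0$, and $\operatorname{Pot}(c_j,\dots,c_l)\ge-1-\operatorname{sign}^+(c_jc_{j+1})$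 if $c_jc_{l-1}<0$. A principal part $Q=\sum_{j<0}c_jX^j$ is called $n$-reduced if the polynomial $\overline Q(X)=X^{-1}Q(X^{-1})=\sum_{i\ge0}c_{-i-1}X^i$ is $(-n)$-reduced. **Theorem.** For every element $g=(x,t^n)$ of $G$, the vector $x$ has an $n$-minimal representative whose polynomial part and principal part are both $n$-reduced. -/

import Mathlib

open scoped LaurentPolynomial Polynomial Matrix

noncomputable section

/-! ### The torus bundle group and its word length -/

/-- The matrix `T = [[0, -1], [1, d]]` in `SL(2, ℤ)`. -/
def torusMatrix (d : ℤ) : Matrix.SpecialLinearGroup (Fin 2) ℤ :=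
  ⟨!![0, -1; 1, d], by simp [Matrix.det_fin_two]⟩

/-- The automorphism `x ↦ T x` of `ℤ²`, with `ℤ²` written multiplicatively. -/
def torusAut (d : ℤ) : MulAut (Multiplicative (Fin 2 → ℤ)) :=
  AddEquiv.toMultiplicative (Matrix.SpecialLinearGroup.toLin' (torusMatrix d)).toAddEquiv

/-- The torus bundle group `G = ℤ² ⋊ ⟨t⟩`, where `t x t⁻¹ = T x`. -/
abbrev TorusBundleGroup (d : ℤ) : Type :=
  SemidirectProduct (Multiplicative (Fin 2 → ℤ)) (Multiplicative ℤ)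
    (zpowersHom (MulAut (Multiplicative (Fin 2 → ℤ))) (torusAut d))

/-- The element `(x, t ^ n)` of `G`. -/
def torusElt (d : ℤ) (x : Fin 2 → ℤ) (n : ℤ) : TorusBundleGroup d :=
  ⟨Multiplicative.ofAdd x, Multiplicative.ofAdd n⟩

/-- The generating set `S = {a, b, t}`. -/
def torusGenerators (d : ℤ) : Set (TorusBundleGroup d) :=
  {torusElt d ![1, 0] 0, torusElt d ![0, 1] 0, torusElt d 0 1}

/-- The word length of `g` with respect to `S`: the least length of a word in the elements of `S`
and their inverses whose product is `g`. (If no word represents `g`, the value is `0`.) -/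
def wordLength {G : Type*} [Group G] (S : Set G) (g : G) : ℕ :=
  sInf {r : ℕ | ∃ w : List G, (∀ s ∈ w, s ∈ S ∨ s⁻¹ ∈ S) ∧ w.prod = g ∧ w.length = r}

/-! ### Laurent polynomials: representatives and `n`-length -/

/-- `F` represents `x`, that is, `x = F(T)(b)` with `b = (0, 1)`. -/
def Represents (d : ℤ) (F : ℤ[T;T⁻¹]) (x : Fin 2 → ℤ) : Prop :=
  x = (F.smeval (Matrix.SpecialLinearGroup.toGL (torusMatrix d)) : Matrix (Fin 2) (Fin 2) ℤ)
    *ᵥ ![0, 1]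

/-- The least `q ≥ max {0, n}` such that all coefficients of `F` in exponents `> q` vanish. -/
def upperExponent (n : ℤ) (F : ℤ[T;T⁻¹]) : ℕ :=
  max n.toNat (F.coeff.support.sup fun j => j.toNat)

/-- The least `p ≥ max {0, -n}` such that all coefficients of `F` in exponents `< -p - 1`
vanish. -/
def lowerExponent (n : ℤ) (F : ℤ[T;T⁻¹]) : ℕ :=
  max (-n).toNat (F.coeff.support.sup fun j => (-j - 1).toNat)

/-- The `n`-length `L_n(F) = 2 p + 2 q - |n| + ∑ |c_j|`. -/
def nLength (n : ℤ) (F : ℤ[T;T⁻¹]) : ℤ :=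
  2 * (lowerExponent n F : ℤ) + 2 * (upperExponent n F : ℤ) - |n|
    + ∑ j ∈ F.coeff.support, |F.coeff j|

/-- `F` is an `n`-minimal representative of `x`: it represents `x`, and its `n`-length is the word
length of `(x, t ^ n)`. -/
def IsMinimalRepresentative (d n : ℤ) (x : Fin 2 → ℤ) (F : ℤ[T;T⁻¹]) : Prop :=
  Represents d F x ∧ nLength n F = (wordLength (torusGenerators d) (torusElt d x n) : ℤ)

/-- The polynomial part `∑_{j ≥ 0} c_j X ^ j` of `F`. -/
def polynomialPart (F : ℤ[T;T⁻¹]) : ℤ[X] := LaurentPolynomial.trunc F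

/-- The principal part `∑_{j < 0} c_j X ^ j` of `F`. -/
def principalPart (F : ℤ[T;T⁻¹]) : ℤ[T;T⁻¹] := F - Polynomial.toLaurent (polynomialPart F)

/-- For `Q` with negative exponents only, the polynomial `X⁻¹ * Q(X⁻¹)`: its coefficient in degree
`i` is the coefficient of `Q` in exponent `-i - 1`. -/
def mirror (Q : ℤ[T;T⁻¹]) : ℤ[X] :=
  LaurentPolynomial.trunc (LaurentPolynomial.T (-1) * LaurentPolynomial.invert Q)

/-! ### Reduced polynomials -/

/-- The coefficient of `P` in degree `i`, with the value `0` for `i < 0`. -/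
def coeffZ (P : ℤ[X]) (i : ℤ) : ℤ := if 0 ≤ i then P.coeff i.toNat else 0

/-- `sign⁺`. -/
def signPlus (x : ℤ) : ℤ := if 0 ≤ x then 1 else -1

/-- The potential of the word `(c_hi, …, c_lo)`. -/
def potential (k : ℤ) (c : ℤ → ℤ) (hi lo : ℤ) : ℤ :=
  ∑ j ∈ Finset.Icc lo hi, ((2 * k - 1) - 2 * |c j|)

/-- Rule 1 (local top rule). -/
def Rule1 (k n m : ℤ) (c : ℤ → ℤ) : Prop :=
  n ≤ m → |c m| ≤ k + 2 ∧ (Int.sign (c m * c (m - 1)) < 0 → |c m| ≤ k + 1)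

/-- Rule 2 (local non-top rule). -/
def Rule2 (k n m : ℤ) (c : ℤ → ℤ) : Prop :=
  ∀ i : ℤ, 0 ≤ i → (i = m ∧ m < n) ∨ i < m →
    |c i| ≤ k + 1 ∧
    (Int.sign (c (i + 1) * c i) < 0 ∨ Int.sign (c i * c (i - 1)) < 0 → |c i| ≤ k) ∧
    (Int.sign (c (i + 1) * c i) < 0 ∧ Int.sign (c i * c (i - 1)) < 0 → |c i| ≤ k - 1)

/-- Rule 3 (local top rule). -/
def Rule3 (k n m : ℤ) (c : ℤ → ℤ) : Prop :=
  n < m → 1 ≤ m → ∀ ε : ℤ, ε = 1 ∨ ε = -1 →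
    ¬ (c m = ε ∧ c (m - 1) = ε * (-k)) ∧
    (Int.sign (c (m - 1) * c (m - 2)) < 0 → ¬ (c m = ε ∧ c (m - 1) = ε * (-k + 1)))

/-- Rule 4 (global top rule); `c' j = ε * c j` with `ε = ±1`. -/
def Rule4 (k n m : ℤ) (c : ℤ → ℤ) : Prop :=
  n < m → ∀ i : ℤ, 1 ≤ i → i ≤ m → ∀ ε : ℤ, ε = 1 ∨ ε = -1 →
    ε * c m = 1 →
    (ε * c (m - 1) = -k + 1 ∨ ε * c (m - 1) = -k + 2) →
    (∀ j : ℤ, 1 < j → j < i → ε * c (m - j) = -k + 1 ∨ ε * c (m - j) = -k) →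
    (ε * c (m - i) = -k ∨ ε * c (m - i) = -k - 1) →
    (0 < Int.sign (c m * c (m - i - 1)) → 2 ≤ potential k c (m - 1) (m - i)) ∧
    (Int.sign (c m * c (m - i - 1)) ≤ 0 → 0 < potential k c (m - 1) (m - i))

/-- Rule 5 (global top rule); `c' j = ε * c j` with `ε = ±1`. -/
def Rule5 (k n m : ℤ) (c : ℤ → ℤ) : Prop :=
  n ≤ m → ∀ i : ℤ, 1 ≤ i → i ≤ m → ∀ ε : ℤ, ε = 1 ∨ ε = -1 →
    (ε * c m = k + 1 ∨ ε * c m = k + 2) →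
    (∀ j : ℤ, 0 < j → j < i → ε * c (m - j) = k - 1 ∨ ε * c (m - j) = k) →
    (ε * c (m - i) = k ∨ ε * c (m - i) = k + 1) →
    (0 ≤ Int.sign (c m * c (m - i - 1)) → -6 < potential k c m (m - i)) ∧
    (Int.sign (c m * c (m - i - 1)) < 0 → -4 ≤ potential k c m (m - i))

/-- Rule 6 (global non-top rule); `c' s = ε * c s` with `ε = ±1`. -/
def Rule6 (k n m : ℤ) (c : ℤ → ℤ) : Prop :=
  ∀ j l : ℤ, 0 ≤ l → l < j → (0 < j ∧ j < m) ∨ (0 < j ∧ j = m ∧ m < n) →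
    ∀ ε : ℤ, ε = 1 ∨ ε = -1 →
    (ε * c j = k ∨ ε * c j = k + 1) →
    (∀ s : ℤ, l < s → s < j → ε * c s = k - 1 ∨ ε * c s = k) →
    (ε * c l = k ∨ ε * c l = k + 1) →
    (0 ≤ Int.sign (c j * c (l - 1)) →
      -3 - signPlus (c j * c (j + 1)) < potential k c j l) ∧
    (Int.sign (c j * c (l - 1)) < 0 →
      -1 - signPlus (c j * c (j + 1)) ≤ potential k c j l)

/-- A polynomial of degree `m` is `n`-reduced if it satisfies Rules 1 to 6. The zero polynomial
satisfies all of them. -/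
def IsNReduced (k n : ℤ) (P : ℤ[X]) : Prop :=
  Rule1 k n P.natDegree (coeffZ P) ∧ Rule2 k n P.natDegree (coeffZ P) ∧
  Rule3 k n P.natDegree (coeffZ P) ∧ Rule4 k n P.natDegree (coeffZ P) ∧
  Rule5 k n P.natDegree (coeffZ P) ∧ Rule6 k n P.natDegree (coeffZ P)

/-- A principal part `Q` is `n`-reduced if the polynomial `X⁻¹ * Q(X⁻¹)` is `(-n)`-reduced:
the reflection of `ℤ` that exchanges the exponents `j ≥ 0` and `j ≤ -1` replaces `t` by `t⁻¹`. -/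
def IsPrincipalNReduced (k n : ℤ) (Q : ℤ[T;T⁻¹]) : Prop := IsNReduced k (-n) (mirror Q)

end

/-! Adding a multiple of X + X⁻¹ - (2k+1) to F does not change F(T)(b). Only finitely many
representatives of x are minimal; let F be one that is maximal for a suitable tie-breaking order.
Then adding ±(X^l + ⋯ + X^j)(X + X⁻¹ - (2k+1)) with l ≥ 0 can neither shorten F nor keep its length
while raising it in the order. Each rule is an instance of this. Rules 1 to 3 come from l = j, Rules
4 to 6 from l < j, where ∑|c_i| changes by the potential of the block plus boundary terms
(`coeffNorm_shiftBlock`) and q changes by at most 1, -1 or 0, depending on where the block ends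
relative to the top degree.

The strict inequalities in the global rules express tie-breaking: if c_{l-1} is zero or has the sign
of the block, the addition raises the order (`tieKey_lt_shiftBlock`). The reflection j ↦ -1 - j,
with n ↦ -n, preserves the length, the relation and the order, so the principal part needs no
separate argument.

Minimal representatives exist because each letter of a word costs at most one unit of n-length
(`exists_nLength_le_of_word`), while F can be spelled with L_n(F) letters (`hasWord_of_nLength`). -/

open LaurentPolynomial (T C)

/-! ### Coefficients -/

/-- The reflection of `ℤ[T;T⁻¹]` exchanging the exponents `j` and `-1 - j`. -/
noncomputable def reflect (F : ℤ[T;T⁻¹]) : ℤ[T;T⁻¹] := T (-1) * LaurentPolynomial.invert F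

theorem coeff_T_mul (F : ℤ[T;T⁻¹]) (i j : ℤ) : (T i * F).coeff j = F.coeff (j - i) := by
  have h := AddMonoidAlgebra.coeff_single_mul_apply F 1 i j
  rw [one_mul, neg_add_eq_sub] at h
  exact h

theorem coeff_C_mul (F : ℤ[T;T⁻¹]) (r j : ℤ) : (C r * F).coeff j = r * F.coeff j := by
  rw [← LaurentPolynomial.smul_eq_C_mul]
  rfl

theorem coeff_reflect (F : ℤ[T;T⁻¹]) (j : ℤ) : (reflect F).coeff j = F.coeff (-1 - j) := by
  rw [reflect, coeff_T_mul, LaurentPolynomial.invert_apply]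
  congr 1
  ring

theorem reflect_reflect (F : ℤ[T;T⁻¹]) : reflect (reflect F) = F := by
  ext j
  simp [coeff_reflect]

theorem coeff_polynomialPart (F : ℤ[T;T⁻¹]) (i : ℕ) : (polynomialPart F).coeff i = F.coeff i :=
  rfl

theorem coeffZ_polynomialPart (F : ℤ[T;T⁻¹]) (i : ℤ) :
    coeffZ (polynomialPart F) i = if 0 ≤ i then F.coeff i else 0 := by
  unfold coeffZ
  split_ifs with h
  · rw [coeff_polynomialPart, Int.toNat_of_nonneg h]
  · rfl

theorem coeff_toLaurent_of_neg (P : ℤ[X]) {i : ℤ} (hi : i < 0) :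
    (Polynomial.toLaurent P).coeff i = 0 := by
  rw [LaurentPolynomial.coeff_toLaurent]
  apply Finsupp.mapDomain_of_notMem_range
  rintro ⟨j, rfl⟩
  simp only [Nat.castEmbedding_apply] at hi
  omega

/-- Only exponents j ≤ -1 survive the mirroring, so removing the polynomial part first is harmless.
Claims about principal parts thus become claims about the polynomial part of `reflect F`. -/
theorem mirror_principalPart (F : ℤ[T;T⁻¹]) :
    mirror (principalPart F) = polynomialPart (reflect F) := by
  ext i
  rw [coeff_polynomialPart, coeff_reflect]
  change (reflect (principalPart F)).coeff i = _
  rw [coeff_reflect, principalPart, AddMonoidAlgebra.coeff_sub, Finsupp.sub_apply,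
    coeff_toLaurent_of_neg _ (by omega), sub_zero]

/-! ### Length -/

/-- The sum of the absolute values of the coefficients. -/
def coeffNorm (F : ℤ[T;T⁻¹]) : ℤ := ∑ j ∈ F.coeff.support, |F.coeff j|

theorem coeffNorm_eq_sum {F : ℤ[T;T⁻¹]} {S : Finset ℤ} (h : F.coeff.support ⊆ S) :
    coeffNorm F = ∑ j ∈ S, |F.coeff j| :=
  Finset.sum_subset h fun j _ hj => by simpa using hj

theorem coeffNorm_sub_coeffNorm {F G : ℤ[T;T⁻¹]} {S : Finset ℤ}
    (h : ∀ j ∉ S, G.coeff j = F.coeff j) :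
    coeffNorm G - coeffNorm F = ∑ j ∈ S, (|G.coeff j| - |F.coeff j|) := by
  classical
  rw [coeffNorm_eq_sum (F := G) (S := (G.coeff.support ∪ F.coeff.support) ∪ S) (by grind),
    coeffNorm_eq_sum (F := F) (S := (G.coeff.support ∪ F.coeff.support) ∪ S) (by grind),
    ← Finset.sum_sub_distrib]
  refine (Finset.sum_subset Finset.subset_union_right fun j _ hj => ?_).symm
  rw [h j hj, sub_self]

theorem upperExponent_le_iff {n : ℤ} {F : ℤ[T;T⁻¹]} {Q : ℤ} (hQ : 0 ≤ Q) :
    (upperExponent n F : ℤ) ≤ Q ↔ n ≤ Q ∧ ∀ j, F.coeff j ≠ 0 → j ≤ Q := by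
  lift Q to ℕ using hQ
  rw [Nat.cast_le, upperExponent, max_le_iff, Finset.sup_le_iff]
  simp [Int.toNat_le]

theorem lowerExponent_le_iff {n : ℤ} {F : ℤ[T;T⁻¹]} {Q : ℤ} (hQ : 0 ≤ Q) :
    (lowerExponent n F : ℤ) ≤ Q ↔ -n ≤ Q ∧ ∀ j, F.coeff j ≠ 0 → -j - 1 ≤ Q := by
  lift Q to ℕ using hQ
  rw [Nat.cast_le, lowerExponent, max_le_iff, Finset.sup_le_iff]
  simp [Int.toNat_le]

theorem le_upperExponent {n : ℤ} {F : ℤ[T;T⁻¹]} {j : ℤ} (h : F.coeff j ≠ 0) :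
    j ≤ upperExponent n F :=
  ((upperExponent_le_iff (by positivity)).1 le_rfl).2 j h

theorem self_le_upperExponent (n : ℤ) (F : ℤ[T;T⁻¹]) : n ≤ upperExponent n F :=
  ((upperExponent_le_iff (by positivity)).1 le_rfl).1

theorem le_lowerExponent {n : ℤ} {F : ℤ[T;T⁻¹]} {j : ℤ} (h : F.coeff j ≠ 0) :
    -j - 1 ≤ lowerExponent n F :=
  ((lowerExponent_le_iff (by positivity)).1 le_rfl).2 j h

theorem neg_le_lowerExponent (n : ℤ) (F : ℤ[T;T⁻¹]) : -n ≤ lowerExponent n F :=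
  ((lowerExponent_le_iff (by positivity)).1 le_rfl).1

theorem upperExponent_reflect (n : ℤ) (F : ℤ[T;T⁻¹]) :
    upperExponent (-n) (reflect F) = lowerExponent n F := by
  zify
  apply le_antisymm
  · refine (upperExponent_le_iff (by positivity)).2 ⟨neg_le_lowerExponent n F, fun j hj => ?_⟩
    rw [coeff_reflect] at hj
    linarith [le_lowerExponent (n := n) hj]
  · refine (lowerExponent_le_iff (by positivity)).2 ⟨self_le_upperExponent _ _, fun j hj => ?_⟩
    apply le_upperExponent
    rw [coeff_reflect]
    convert hj using 2
    ring

theorem lowerExponent_reflect (n : ℤ) (F : ℤ[T;T⁻¹]) :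
    lowerExponent (-n) (reflect F) = upperExponent n F := by
  rw [← upperExponent_reflect, reflect_reflect, neg_neg]

theorem coeffNorm_reflect_le (F : ℤ[T;T⁻¹]) : coeffNorm (reflect F) ≤ coeffNorm F := by
  classical
  rw [coeffNorm_eq_sum (F := reflect F) (S := F.coeff.support.image fun j => -1 - j)]
  · rw [Finset.sum_image (by intro a _ b _ h; simpa using h)]
    refine le_of_eq (Finset.sum_congr rfl fun j _ => ?_)
    rw [coeff_reflect]
    congr 2
    ring
  · intro j hj
    rw [Finsupp.mem_support_iff, coeff_reflect] at hj
    exact Finset.mem_image.2 ⟨-1 - j, by simpa using hj, by ring⟩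

theorem coeffNorm_reflect (F : ℤ[T;T⁻¹]) : coeffNorm (reflect F) = coeffNorm F := by
  refine le_antisymm (coeffNorm_reflect_le F) ?_
  conv_lhs => rw [← reflect_reflect F]
  exact coeffNorm_reflect_le _

theorem nLength_eq (n : ℤ) (F : ℤ[T;T⁻¹]) :
    nLength n F = 2 * lowerExponent n F + 2 * upperExponent n F - |n| + coeffNorm F :=
  rfl

theorem nLength_reflect (n : ℤ) (F : ℤ[T;T⁻¹]) : nLength (-n) (reflect F) = nLength n F := by
  rw [nLength_eq, nLength_eq, upperExponent_reflect, lowerExponent_reflect, coeffNorm_reflect,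
    abs_neg]
  ring

/-! ### The characteristic relation -/

/-- The Laurent polynomial `X + X⁻¹ - d`, which annihilates the matrix `T`. -/
noncomputable def charRel (d : ℤ) : ℤ[T;T⁻¹] := T 1 + T (-1) - C d

theorem coeff_mul_charRel (d : ℤ) (A : ℤ[T;T⁻¹]) (s : ℤ) :
    (A * charRel d).coeff s = A.coeff (s - 1) + A.coeff (s + 1) - d * A.coeff s := by
  rw [mul_comm, charRel, sub_mul, add_mul]
  simp only [AddMonoidAlgebra.coeff_sub, AddMonoidAlgebra.coeff_add, Finsupp.sub_apply,
    Finsupp.add_apply, coeff_T_mul, coeff_C_mul, sub_neg_eq_add]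

/-- The relation is invariant under X ↦ X⁻¹. -/
theorem reflect_add_mul_charRel (d : ℤ) (F A : ℤ[T;T⁻¹]) :
    reflect (F + A * charRel d) = reflect F + reflect A * charRel d := by
  simp only [reflect, charRel, map_add, map_mul, map_sub, LaurentPolynomial.invert_T,
    LaurentPolynomial.invert_C, neg_neg]
  ring

/-- The polynomial `X ^ l + ⋯ + X ^ j`. -/
noncomputable def geomBlock (l j : ℤ) : ℤ[T;T⁻¹] := ∑ i ∈ Finset.Icc l j, T i

theorem coeff_geomBlock (l j s : ℤ) :
    (geomBlock l j).coeff s = if l ≤ s ∧ s ≤ j then 1 else 0 := by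
  simp [geomBlock, AddMonoidAlgebra.coeff_sum, Finsupp.finsetSum_apply]

/-- The Laurent polynomial `F + ε (X ^ l + ⋯ + X ^ j) (X + X⁻¹ - d)`. -/
noncomputable def shiftBlock (d ε l j : ℤ) (F : ℤ[T;T⁻¹]) : ℤ[T;T⁻¹] :=
  F + (C ε * geomBlock l j) * charRel d

theorem coeff_shiftBlock (d ε l j : ℤ) (F : ℤ[T;T⁻¹]) (s : ℤ) :
    (shiftBlock d ε l j F).coeff s = F.coeff s + ε * ((if l ≤ s - 1 ∧ s - 1 ≤ j then 1 else 0) +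
      (if l ≤ s + 1 ∧ s + 1 ≤ j then 1 else 0) - d * (if l ≤ s ∧ s ≤ j then 1 else 0)) := by
  rw [shiftBlock, AddMonoidAlgebra.coeff_add, Finsupp.add_apply, coeff_mul_charRel]
  simp only [coeff_C_mul, coeff_geomBlock]
  ring

theorem coeff_shiftBlock_of_notMem (d ε : ℤ) {l j : ℤ} (F : ℤ[T;T⁻¹]) {s : ℤ}
    (hs : s < l - 1 ∨ j + 1 < s) : (shiftBlock d ε l j F).coeff s = F.coeff s := by
  rw [coeff_shiftBlock, if_neg (by omega), if_neg (by omega), if_neg (by omega)]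
  ring

theorem coeff_shiftBlock_pred (d ε : ℤ) {l j : ℤ} (hlj : l ≤ j) (F : ℤ[T;T⁻¹]) :
    (shiftBlock d ε l j F).coeff (l - 1) = F.coeff (l - 1) + ε := by
  rw [coeff_shiftBlock, if_neg (by omega), if_pos (by omega), if_neg (by omega)]
  ring

theorem coeff_shiftBlock_succ (d ε : ℤ) {l j : ℤ} (hlj : l ≤ j) (F : ℤ[T;T⁻¹]) :
    (shiftBlock d ε l j F).coeff (j + 1) = F.coeff (j + 1) + ε := by
  rw [coeff_shiftBlock, if_pos (by omega), if_neg (by omega), if_neg (by omega)]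
  ring

theorem coeff_shiftBlock_single (d ε l : ℤ) (F : ℤ[T;T⁻¹]) :
    (shiftBlock d ε l l F).coeff l = F.coeff l - ε * d := by
  rw [coeff_shiftBlock, if_neg (by omega), if_neg (by omega), if_pos (by omega)]
  ring

theorem coeff_shiftBlock_left (d ε : ℤ) {l j : ℤ} (hlj : l < j) (F : ℤ[T;T⁻¹]) :
    (shiftBlock d ε l j F).coeff l = F.coeff l - ε * (d - 1) := by
  rw [coeff_shiftBlock, if_neg (by omega), if_pos (by omega), if_pos (by omega)]
  ring

theorem coeff_shiftBlock_right (d ε : ℤ) {l j : ℤ} (hlj : l < j) (F : ℤ[T;T⁻¹]) :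
    (shiftBlock d ε l j F).coeff j = F.coeff j - ε * (d - 1) := by
  rw [coeff_shiftBlock, if_pos (by omega), if_neg (by omega), if_pos (by omega)]
  ring

theorem coeff_shiftBlock_mid (d ε : ℤ) {l j s : ℤ} (hl : l < s) (hj : s < j) (F : ℤ[T;T⁻¹]) :
    (shiftBlock d ε l j F).coeff s = F.coeff s - ε * (d - 2) := by
  rw [coeff_shiftBlock, if_pos (by omega), if_pos (by omega), if_pos (by omega)]
  ring

/-- The change of the absolute value of `c` when `ε` is added. -/
def absStep (ε c : ℤ) : ℤ := |c + ε| - |c|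

theorem absStep_eq {ε : ℤ} (hε : ε = 1 ∨ ε = -1) (c : ℤ) : absStep ε c = signPlus (ε * c) := by
  unfold absStep signPlus
  rcases hε with rfl | rfl <;> split_ifs <;> grind

theorem absStep_le {ε : ℤ} (hε : ε = 1 ∨ ε = -1) (c : ℤ) : absStep ε c ≤ 1 := by
  rw [absStep_eq hε, signPlus]
  split_ifs <;> simp

/-! ### Change of length and support when a block is added -/

theorem coeffNorm_shiftBlock_single (d ε l : ℤ) (F : ℤ[T;T⁻¹]) :
    coeffNorm (shiftBlock d ε l l F) - coeffNorm F = (|F.coeff l - ε * d| - |F.coeff l|) +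
      absStep ε (F.coeff (l + 1)) + absStep ε (F.coeff (l - 1)) := by
  rw [coeffNorm_sub_coeffNorm (S := Finset.Icc (l - 1) (l + 1))]
  · rw [show Finset.Icc (l - 1) (l + 1) = {l - 1, l, l + 1} by ext; simp; omega,
      Finset.sum_insert (by simp; omega), Finset.sum_insert (by simp), Finset.sum_singleton,
      coeff_shiftBlock_pred _ _ le_rfl, coeff_shiftBlock_succ _ _ le_rfl, coeff_shiftBlock_single]
    unfold absStep
    ring
  · intro s hs
    rw [Finset.mem_Icc] at hs
    exact coeff_shiftBlock_of_notMem _ _ _ (by omega)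

theorem abs_sub_mul_sub_abs {ε a c : ℤ} (hε : ε = 1 ∨ ε = -1) (h0 : 0 ≤ ε * c) (h1 : ε * c ≤ a) :
    |c - ε * a| - |c| = a - 2 * |c| := by
  rcases hε with rfl | rfl <;> grind

/-- Inner coefficients move by 2k - 1 towards and past zero, so |c| becomes 2k - 1 - |c|. The two
end coefficients move by 2k, one more each, which gives the constant 2. The two neighbours of the
block move by ε. -/
theorem coeffNorm_shiftBlock {k ε l j : ℤ} (hε : ε = 1 ∨ ε = -1) (hlj : l < j) {F : ℤ[T;T⁻¹]}
    (hj : 0 ≤ ε * F.coeff j ∧ ε * F.coeff j ≤ 2 * k)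
    (hl : 0 ≤ ε * F.coeff l ∧ ε * F.coeff l ≤ 2 * k)
    (hmid : ∀ s, l < s → s < j → 0 ≤ ε * F.coeff s ∧ ε * F.coeff s ≤ 2 * k - 1) :
    coeffNorm (shiftBlock (2 * k + 1) ε l j F) - coeffNorm F = potential k F.coeff j l + 2 +
      absStep ε (F.coeff (j + 1)) + absStep ε (F.coeff (l - 1)) := by
  rw [coeffNorm_sub_coeffNorm (S := Finset.Icc (l - 1) (j + 1))]
  · have hterm : ∀ s ∈ Finset.Icc (l - 1) (j + 1),
        |(shiftBlock (2 * k + 1) ε l j F).coeff s| - |F.coeff s| =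
          (if l ≤ s ∧ s ≤ j then (2 * k - 1) - 2 * |F.coeff s| else 0) +
          ((if s = l then 1 else 0) + (if s = j then 1 else 0)) +
          (if s = j + 1 then absStep ε (F.coeff (j + 1)) else 0) +
          (if s = l - 1 then absStep ε (F.coeff (l - 1)) else 0) := by
      intro s hs
      rw [Finset.mem_Icc] at hs
      rcases eq_or_lt_of_le hs.1 with h | h
      · subst h
        rw [if_neg (by omega), if_neg (by omega), if_neg (by omega), if_neg (by omega),
          if_pos rfl, coeff_shiftBlock_pred _ _ hlj.le]
        unfold absStep
        ring
      rcases eq_or_lt_of_le hs.2 with h' | h'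
      · subst h'
        rw [if_neg (by omega), if_neg (by omega), if_neg (by omega), if_pos rfl,
          if_neg (by omega), coeff_shiftBlock_succ _ _ hlj.le]
        unfold absStep
        ring
      rw [if_pos (by omega), if_neg (show ¬ s = j + 1 by omega),
        if_neg (show ¬ s = l - 1 by omega)]
      by_cases hsl : s = l
      · subst hsl
        rw [if_pos rfl, if_neg (by omega), coeff_shiftBlock_left _ _ hlj,
          abs_sub_mul_sub_abs hε hl.1 (by omega)]
        ring
      by_cases hsj : s = j
      · subst hsj
        rw [if_neg hsl, if_pos rfl, coeff_shiftBlock_right _ _ hlj,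
          abs_sub_mul_sub_abs hε hj.1 (by omega)]
        ring
      rw [if_neg hsl, if_neg hsj, coeff_shiftBlock_mid _ _ (by omega) (by omega),
        abs_sub_mul_sub_abs hε (hmid s (by omega) (by omega)).1
          (by linarith [(hmid s (by omega) (by omega)).2])]
      ring
    rw [Finset.sum_congr rfl hterm]
    simp only [Finset.sum_add_distrib, Finset.sum_ite_eq', Finset.mem_Icc]
    rw [if_pos (by omega), if_pos (by omega), if_pos (by omega), if_pos (by omega),
      ← Finset.sum_filter,
      show Finset.filter (fun s => l ≤ s ∧ s ≤ j) (Finset.Icc (l - 1) (j + 1)) = Finset.Icc l j by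
        ext; simp; omega]
    unfold potential
    ring
  · intro s hs
    rw [Finset.mem_Icc] at hs
    exact coeff_shiftBlock_of_notMem _ _ _ (by omega)

theorem upperExponent_shiftBlock_le {n : ℤ} {d ε l j Q : ℤ} {F : ℤ[T;T⁻¹]} (hQ : 0 ≤ Q)
    (hn : n ≤ Q) (hF : ∀ s, j + 1 < s → F.coeff s ≠ 0 → s ≤ Q)
    (hj : j ≤ Q) (hj' : j + 1 ≤ Q ∨ F.coeff (j + 1) + ε = 0) (hlj : l ≤ j) :
    (upperExponent n (shiftBlock d ε l j F) : ℤ) ≤ Q := by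
  refine (upperExponent_le_iff hQ).2 ⟨hn, fun s hs => ?_⟩
  rcases lt_trichotomy s (j + 1) with h | rfl | h
  · omega
  · rw [coeff_shiftBlock_succ _ _ hlj] at hs
    tauto
  · rw [coeff_shiftBlock_of_notMem _ _ _ (Or.inr h)] at hs
    exact hF s h hs

/-- A block with l ≥ 0 reaches down to exponent -1 at most, and that exponent imposes nothing on p.
-/
theorem lowerExponent_shiftBlock_le (n : ℤ) {d ε l j : ℤ} (F : ℤ[T;T⁻¹]) (hl : 0 ≤ l) :
    (lowerExponent n (shiftBlock d ε l j F) : ℤ) ≤ lowerExponent n F := by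
  refine (lowerExponent_le_iff (by positivity)).2 ⟨neg_le_lowerExponent n F, fun s hs => ?_⟩
  by_cases h : s < l - 1
  · rw [coeff_shiftBlock_of_notMem _ _ _ (Or.inl h)] at hs
    exact le_lowerExponent hs
  · omega

/-! ### The tie-breaking order -/

/-- The absolute values of the coefficients in degrees `0, 1, 2, …`, ordered lexicographically. -/
noncomputable def absCoeffs (F : ℤ[T;T⁻¹]) : Lex (ℕ → ℤ) := toLex fun i => |F.coeff i|

/-- The indicator of the event that the coefficients in exponents `0` and `-1` have opposite
signs. -/
noncomputable def crossing (F : ℤ[T;T⁻¹]) : ℕ := if F.coeff 0 * F.coeff (-1) < 0 then 1 else 0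

/-- The quantity that decides between representatives of equal length. -/
noncomputable def tieKey (F : ℤ[T;T⁻¹]) : ℕ ×ₗ (Lex (ℕ → ℤ) × Lex (ℕ → ℤ)) :=
  toLex (crossing F, (absCoeffs F, absCoeffs (reflect F)))

theorem crossing_reflect (F : ℤ[T;T⁻¹]) : crossing (reflect F) = crossing F := by
  simp [crossing, coeff_reflect, mul_comm]

theorem tieKey_lt_iff {F G : ℤ[T;T⁻¹]} : tieKey F < tieKey G ↔ crossing F < crossing G ∨
    crossing F = crossing G ∧
      (absCoeffs F, absCoeffs (reflect F)) < (absCoeffs G, absCoeffs (reflect G)) :=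
  Prod.Lex.lt_iff

/-- The two coefficient sequences are compared in the product order, not lexicographically, to make
this symmetry hold. The order is then only partial, but maximal elements suffice. -/
theorem tieKey_reflect_lt {F G : ℤ[T;T⁻¹]} (h : tieKey F < tieKey G) :
    tieKey (reflect F) < tieKey (reflect G) := by
  rw [tieKey_lt_iff] at h ⊢
  rw [crossing_reflect, crossing_reflect, reflect_reflect, reflect_reflect]
  refine h.imp_right (And.imp_right fun h => ?_)
  rw [Prod.lt_iff] at h ⊢
  exact h.symm.imp And.symm And.symm

/-- For l > 0 the lowest coefficient to change is c_{l-1}, which grows in absolute value, and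
negative exponents are untouched. For l = 0 the change reaches exponent -1, so `crossing` decides:
c_0 and c_{-1} do not have opposite signs before the addition, but do afterwards. -/
theorem tieKey_lt_shiftBlock {k ε l j : ℤ} (hε : ε = 1 ∨ ε = -1) (hl : 0 ≤ l) (hlj : l < j)
    {F : ℤ[T;T⁻¹]} (h0 : 0 < ε * F.coeff l) (h1 : ε * F.coeff l < 2 * k)
    (hpred : 0 ≤ ε * F.coeff (l - 1)) :
    tieKey F < tieKey (shiftBlock (2 * k + 1) ε l j F) := by
  rw [tieKey_lt_iff]
  rcases eq_or_lt_of_le hl with rfl | hl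
  · left
    have e0 := coeff_shiftBlock_left (2 * k + 1) ε hlj F
    have e1 := coeff_shiftBlock_pred (2 * k + 1) ε hlj.le F
    rw [zero_sub] at e1 hpred
    unfold crossing
    rw [e0, e1, if_neg, if_pos]
    · exact zero_lt_one
    · rcases hε with rfl | rfl <;> nlinarith
    · rcases hε with rfl | rfl <;> nlinarith
  have hlt : absCoeffs F < absCoeffs (shiftBlock (2 * k + 1) ε l j F) := by
    refine ⟨(l - 1).toNat, fun i hi => ?_, ?_⟩
    · simp only [absCoeffs]
      change |F.coeff i| = |(shiftBlock (2 * k + 1) ε l j F).coeff i|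
      rw [coeff_shiftBlock_of_notMem _ _ _ (Or.inl (by omega))]
    · change |F.coeff ((l - 1).toNat : ℤ)| <
        |(shiftBlock (2 * k + 1) ε l j F).coeff ((l - 1).toNat : ℤ)|
      rw [Int.toNat_of_nonneg (by omega), coeff_shiftBlock_pred _ _ hlj.le]
      rcases hε with rfl | rfl <;> grind
  have hrefl : absCoeffs (reflect F) = absCoeffs (reflect (shiftBlock (2 * k + 1) ε l j F)) := by
    refine congrArg toLex (funext fun i => ?_)
    rw [coeff_reflect, coeff_reflect, coeff_shiftBlock_of_notMem _ _ _ (Or.inl (by omega))]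
  have hpair : (absCoeffs F, absCoeffs (reflect F)) <
      (absCoeffs (shiftBlock (2 * k + 1) ε l j F),
        absCoeffs (reflect (shiftBlock (2 * k + 1) ε l j F))) :=
    Prod.lt_iff.2 (Or.inl ⟨hlt, hrefl.le⟩)
  have hcross : crossing F ≤ crossing (shiftBlock (2 * k + 1) ε l j F) := by
    unfold crossing
    rw [coeff_shiftBlock_of_notMem _ _ (s := -1) _ (Or.inl (by omega))]
    -- If l = 1, a nonzero c_0 with the sign of ε moves away from zero, so an existing crossing is
    -- not lost.
    by_cases hl1 : l = 1
    · subst hl1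
      have e1 := coeff_shiftBlock_pred (2 * k + 1) ε hlj.le F
      rw [sub_self] at e1 hpred
      rw [e1]
      split_ifs with h h'
      · exact le_rfl
      · exfalso
        apply h'
        rcases hε with rfl | rfl <;> rcases mul_neg_iff.1 h with h | h <;> nlinarith
      · exact zero_le_one
      · exact le_rfl
    · rw [coeff_shiftBlock_of_notMem _ _ (s := 0) _ (Or.inl (by omega))]
  rcases hcross.lt_or_eq with h | h
  · exact Or.inl h
  · exact Or.inr ⟨h, hpair⟩

/-! ### Optimal representatives -/

/-- `F` has least `n`-length among the polynomials congruent to it modulo the characteristic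
relation, and is maximal for the tie-breaking order among those of this length. -/
structure IsOptimal (d n : ℤ) (F : ℤ[T;T⁻¹]) : Prop where
  nLength_le : ∀ A, nLength n F ≤ nLength n (F + A * charRel d)
  not_lt : ∀ A, nLength n (F + A * charRel d) = nLength n F →
    ¬ tieKey F < tieKey (F + A * charRel d)

theorem IsOptimal.reflect {d n : ℤ} {F : ℤ[T;T⁻¹]} (h : IsOptimal d n F) :
    IsOptimal d (-n) (reflect F) := by
  have key : ∀ A, _root_.reflect F + A * charRel d =
      _root_.reflect (F + _root_.reflect A * charRel d) := fun A => by
    rw [reflect_add_mul_charRel, reflect_reflect]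
  refine ⟨fun A => ?_, fun A hA hlt => ?_⟩
  · rw [key, nLength_reflect, nLength_reflect]
    exact h.nLength_le _
  · rw [key, nLength_reflect, nLength_reflect] at hA
    rw [key] at hlt
    have := tieKey_reflect_lt hlt
    rw [reflect_reflect, reflect_reflect] at this
    exact h.not_lt _ hA this

theorem IsOptimal.shiftBlock_nonneg {d n : ℤ} {F : ℤ[T;T⁻¹]} (h : IsOptimal d n F)
    {ε l j e : ℤ} (hl : 0 ≤ l)
    (he : (upperExponent n (shiftBlock d ε l j F) : ℤ) ≤ upperExponent n F + e) :
    0 ≤ coeffNorm (shiftBlock d ε l j F) - coeffNorm F + 2 * e ∧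
      (tieKey F < tieKey (shiftBlock d ε l j F) →
        0 < coeffNorm (shiftBlock d ε l j F) - coeffNorm F + 2 * e) := by
  have h1 := h.nLength_le (C ε * geomBlock l j)
  have h2 := h.not_lt (C ε * geomBlock l j)
  have h3 := lowerExponent_shiftBlock_le n (d := d) (ε := ε) (j := j) F hl
  change nLength n F ≤ nLength n (shiftBlock d ε l j F) at h1
  change nLength n (shiftBlock d ε l j F) = nLength n F →
    ¬ tieKey F < tieKey (shiftBlock d ε l j F) at h2
  rw [nLength_eq, nLength_eq] at h1 h2
  refine ⟨by linarith, fun hlt => ?_⟩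
  by_contra hle
  exact h2 (by linarith) hlt

/-- No strict version is needed: for odd d and ε = ±1 the right-hand side is odd, so ties cannot
occur. -/
theorem IsOptimal.single_nonneg {d n : ℤ} {F : ℤ[T;T⁻¹]} (h : IsOptimal d n F)
    {ε l e : ℤ} (hl : 0 ≤ l)
    (he : (upperExponent n (shiftBlock d ε l l F) : ℤ) ≤ upperExponent n F + e) :
    0 ≤ (|F.coeff l - ε * d| - |F.coeff l|) +
      absStep ε (F.coeff (l + 1)) + absStep ε (F.coeff (l - 1)) + 2 * e := by
  rw [← coeffNorm_shiftBlock_single]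
  exact (h.shiftBlock_nonneg hl he).1

/-- Common source of Rules 4, 5 and 6, with e = -1, 1 and 0. The constants 3 and 1 are 2 ± 1, the
sign being the effect on |c_{l-1}|. The first bound is strict because a tie would raise the order.
-/
theorem IsOptimal.block_bounds {k n : ℤ} {F : ℤ[T;T⁻¹]} (h : IsOptimal (2 * k + 1) n F)
    {ε l j e : ℤ} (hε : ε = 1 ∨ ε = -1) (hl : 0 ≤ l) (hlj : l < j)
    (hcj : 0 ≤ ε * F.coeff j ∧ ε * F.coeff j ≤ 2 * k)
    (hcl : 0 < ε * F.coeff l ∧ ε * F.coeff l < 2 * k)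
    (hmid : ∀ s, l < s → s < j → 0 ≤ ε * F.coeff s ∧ ε * F.coeff s ≤ 2 * k - 1)
    (he : (upperExponent n (shiftBlock (2 * k + 1) ε l j F) : ℤ) ≤ upperExponent n F + e) :
    (0 ≤ ε * F.coeff (l - 1) →
      0 < potential k F.coeff j l + 3 + absStep ε (F.coeff (j + 1)) + 2 * e) ∧
    (ε * F.coeff (l - 1) < 0 →
      0 ≤ potential k F.coeff j l + 1 + absStep ε (F.coeff (j + 1)) + 2 * e) := by
  have h1 := h.shiftBlock_nonneg hl he
  rw [coeffNorm_shiftBlock hε hlj hcj ⟨hcl.1.le, hcl.2.le⟩ hmid,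
    absStep_eq hε (F.coeff (l - 1))] at h1
  refine ⟨fun hs => ?_, fun hs => ?_⟩
  · have := h1.2 (tieKey_lt_shiftBlock hε hl hlj hcl.1 hcl.2 hs)
    rw [signPlus, if_pos hs] at this
    linarith
  · have := h1.1
    rw [signPlus, if_neg (not_le.2 hs)] at this
    linarith

/-! ### Optimal representatives are reduced -/

theorem coeff_eq_zero_of_natDegree_lt {F : ℤ[T;T⁻¹]} {j : ℤ}
    (hj : ((polynomialPart F).natDegree : ℤ) < j) : F.coeff j = 0 := by
  have h := Polynomial.coeff_eq_zero_of_natDegree_lt (p := polynomialPart F) (n := j.toNat)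
    (by omega)
  rwa [coeff_polynomialPart, Int.toNat_of_nonneg (by omega)] at h

theorem coeff_natDegree_ne_zero {F : ℤ[T;T⁻¹]} (h : 1 ≤ ((polynomialPart F).natDegree : ℤ)) :
    F.coeff ((polynomialPart F).natDegree : ℤ) ≠ 0 := by
  rw [← coeff_polynomialPart]
  refine fun h0 => ?_
  rw [Polynomial.coeff_natDegree, Polynomial.leadingCoeff_eq_zero] at h0
  rw [h0] at h
  simp at h

theorem natDegree_le_upperExponent (n : ℤ) (F : ℤ[T;T⁻¹]) :
    ((polynomialPart F).natDegree : ℤ) ≤ upperExponent n F := by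
  by_cases h : 1 ≤ ((polynomialPart F).natDegree : ℤ)
  · exact le_upperExponent (coeff_natDegree_ne_zero h)
  · omega

theorem potential_coeffZ (k : ℤ) (F : ℤ[T;T⁻¹]) {hi lo : ℤ} (hlo : 0 ≤ lo) :
    potential k (coeffZ (polynomialPart F)) hi lo = potential k F.coeff hi lo := by
  refine Finset.sum_congr rfl fun s hs => ?_
  rw [coeffZ_polynomialPart, if_pos (hlo.trans (Finset.mem_Icc.1 hs).1)]

/-! ### Effect of a block on the upper exponent, by the position of its upper end -/

variable {k n : ℤ} {F : ℤ[T;T⁻¹]}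

theorem upperExponent_shiftBlock_inner (d ε : ℤ) {l j : ℤ} (hlj : l ≤ j)
    (hj : (j = ((polynomialPart F).natDegree : ℤ) ∧ ((polynomialPart F).natDegree : ℤ) < n) ∨
      j < ((polynomialPart F).natDegree : ℤ)) :
    (upperExponent n (shiftBlock d ε l j F) : ℤ) ≤ upperExponent n F + 0 := by
  have h1 := natDegree_le_upperExponent n F
  have h2 := self_le_upperExponent n F
  exact upperExponent_shiftBlock_le (by omega) (by omega)
    (fun s _ hs => (le_upperExponent (n := n) hs).trans (by omega)) (by omega) (Or.inl (by omega))
    hlj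

theorem upperExponent_shiftBlock_top (d ε : ℤ) {l j : ℤ} (hlj : l ≤ j)
    (hj : j = ((polynomialPart F).natDegree : ℤ)) :
    (upperExponent n (shiftBlock d ε l j F) : ℤ) ≤ upperExponent n F + 1 := by
  have h1 := natDegree_le_upperExponent n F
  have h2 := self_le_upperExponent n F
  exact upperExponent_shiftBlock_le (by omega) (by omega)
    (fun s _ hs => (le_upperExponent (n := n) hs).trans (by omega)) (by omega) (Or.inl (by omega))
    hlj

/-- The leading coefficient is cancelled, and n < m lets q follow the degree down. -/
theorem upperExponent_shiftBlock_drop (d : ℤ) {ε l j : ℤ} (hlj : l ≤ j) (hl : 0 ≤ l)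
    (hj : j + 1 = ((polynomialPart F).natDegree : ℤ))
    (hn : n < ((polynomialPart F).natDegree : ℤ)) (hε : F.coeff (j + 1) + ε = 0) :
    (upperExponent n (shiftBlock d ε l j F) : ℤ) ≤ upperExponent n F + (-1) := by
  have h1 := natDegree_le_upperExponent n F
  exact upperExponent_shiftBlock_le (by omega) (by omega)
    (fun s hs hs' => absurd (coeff_eq_zero_of_natDegree_lt (by omega)) hs') (by omega) (Or.inr hε)
    hlj

/-- The rules see 0 at exponent -1, where F may have a nonzero coefficient. A negative product in a
rule is therefore genuine, whereas a nonnegative one may hide either sign. -/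
theorem mul_coeff_pred_neg {a : ℤ} {i : ℤ}
    (h : Int.sign (a * coeffZ (polynomialPart F) (i - 1)) < 0) : a * F.coeff (i - 1) < 0 := by
  rw [Int.sign_neg_iff, coeffZ_polynomialPart] at h
  split_ifs at h with h'
  · exact h
  · simp at h

theorem exists_sign (c : ℤ) : ∃ ε : ℤ, (ε = 1 ∨ ε = -1) ∧ 0 ≤ ε * c ∧ ε * c = |c| := by
  rcases le_total 0 c with h | h
  · exact ⟨1, Or.inl rfl, by simpa, by simp [abs_of_nonneg h]⟩
  · exact ⟨-1, Or.inr rfl, by simpa, by simp [abs_of_nonpos h]⟩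

theorem absStep_of_mul_neg {ε a b : ℤ} (hε : ε = 1 ∨ ε = -1) (ha : 0 ≤ ε * a) (h : a * b < 0) :
    absStep ε b = -1 := by
  rw [absStep_eq hε, signPlus, if_neg]
  rcases hε with rfl | rfl <;> rcases mul_neg_iff.1 h with h | h <;> linarith

/-! ### The local rules -/

theorem IsOptimal.rule1 (h : IsOptimal (2 * k + 1) n F) (hk : 2 ≤ k) :
    Rule1 k n (polynomialPart F).natDegree (coeffZ (polynomialPart F)) := by
  intro hn
  set m : ℤ := ((polynomialPart F).natDegree : ℤ) with hm
  have hm0 : 0 ≤ m := by omega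
  obtain ⟨ε, hε, h0, habs⟩ := exists_sign (F.coeff m)
  have key := h.single_nonneg (ε := ε) hm0 (upperExponent_shiftBlock_top _ _ le_rfl hm)
  have h1 := absStep_le hε (F.coeff (m + 1))
  have h2 := absStep_le hε (F.coeff (m - 1))
  rw [show coeffZ (polynomialPart F) m = F.coeff m by rw [coeffZ_polynomialPart, if_pos hm0]]
  constructor
  -- For |c_m| = k + 3 the total change is at most (2k + 1) - 2(k + 3) + 1 + 1 + 2 = -1; k ≥ 2 keeps
  -- it negative beyond 2k + 1 too.
  · rcases hε with rfl | rfl <;> grind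
  · intro hs
    rw [absStep_of_mul_neg hε h0 (mul_coeff_pred_neg hs)] at key
    rcases hε with rfl | rfl <;> grind

theorem IsOptimal.rule2 (h : IsOptimal (2 * k + 1) n F) (hk : 2 ≤ k) :
    Rule2 k n (polynomialPart F).natDegree (coeffZ (polynomialPart F)) := by
  intro i hi0 hi
  obtain ⟨ε, hε, h0, habs⟩ := exists_sign (F.coeff i)
  have key := h.single_nonneg (ε := ε) hi0 (upperExponent_shiftBlock_inner _ _ le_rfl hi)
  have h1 := absStep_le hε (F.coeff (i + 1))
  have h2 := absStep_le hε (F.coeff (i - 1))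
  rw [show coeffZ (polynomialPart F) i = F.coeff i by rw [coeffZ_polynomialPart, if_pos hi0],
    show coeffZ (polynomialPart F) (i + 1) = F.coeff (i + 1) by
      rw [coeffZ_polynomialPart, if_pos (by omega)]]
  have hsucc : Int.sign (F.coeff (i + 1) * F.coeff i) < 0 → absStep ε (F.coeff (i + 1)) = -1 :=
    fun hs => absStep_of_mul_neg hε h0 (by rwa [mul_comm, Int.sign_neg_iff] at hs)
  have hpred : Int.sign (F.coeff i * coeffZ (polynomialPart F) (i - 1)) < 0 →
      absStep ε (F.coeff (i - 1)) = -1 :=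
    fun hs => absStep_of_mul_neg hε h0 (mul_coeff_pred_neg hs)
  refine ⟨?_, ?_, ?_⟩
  · rcases hε with rfl | rfl <;> grind
  · rintro (hs | hs)
    · have := hsucc hs
      rcases hε with rfl | rfl <;> grind
    · have := hpred hs
      rcases hε with rfl | rfl <;> grind
  · rintro ⟨hs, hs'⟩
    have := hsucc hs
    have := hpred hs'
    rcases hε with rfl | rfl <;> grind

theorem IsOptimal.rule3 (h : IsOptimal (2 * k + 1) n F) (hk : 2 ≤ k) :
    Rule3 k n (polynomialPart F).natDegree (coeffZ (polynomialPart F)) := by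
  intro hn hm1 ε hε
  set m : ℤ := ((polynomialPart F).natDegree : ℤ) with hm
  have hε' : -ε = 1 ∨ -ε = -1 := by omega
  rw [show coeffZ (polynomialPart F) m = F.coeff m by
      rw [coeffZ_polynomialPart, if_pos (by omega)],
    show coeffZ (polynomialPart F) (m - 1) = F.coeff (m - 1) by
      rw [coeffZ_polynomialPart, if_pos (by omega)]]
  -- The sign -ε cancels the leading coefficient, so q drops by one and the change includes -2.
  have key : F.coeff m = ε → _ := fun hc =>
    h.single_nonneg (ε := -ε) (l := m - 1) (by omega)
      (upperExponent_shiftBlock_drop _ le_rfl (by omega) (by omega) hn (by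
        rw [sub_add_cancel, hc, add_neg_cancel]))
  rw [sub_add_cancel] at key
  have h2 := absStep_le hε' (F.coeff (m - 1 - 1))
  have h3 : F.coeff m = ε → absStep (-ε) (F.coeff m) = -1 := by
    rintro hc
    rw [hc]
    rcases hε with rfl | rfl <;> rfl
  constructor
  · rintro ⟨hc, hc'⟩
    have key := key hc
    rw [h3 hc, hc'] at key
    rcases hε with rfl | rfl <;> grind
  · rintro hs ⟨hc, hc'⟩
    rw [show m - 2 = m - 1 - 1 by ring] at hs
    have key := key hc
    rw [h3 hc, absStep_of_mul_neg hε' _ (mul_coeff_pred_neg hs), hc'] at key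
    · rcases hε with rfl | rfl <;> grind
    · rw [hc']
      rcases hε with rfl | rfl <;> linarith

/-! ### The global rules -/

theorem sign_mul_nonneg_iff {ε a b : ℤ} (hε : ε = 1 ∨ ε = -1) (ha : 0 < ε * a) :
    0 ≤ Int.sign (a * b) ↔ 0 ≤ ε * b := by
  rw [Int.sign_nonneg_iff]
  rcases hε with rfl | rfl
  · rw [one_mul] at ha ⊢
    exact mul_nonneg_iff_of_pos_left ha
  · have : a * b = -a * (-1 * b) := by ring
    rw [this]
    exact mul_nonneg_iff_of_pos_left (by linarith)

theorem sign_mul_neg_iff {ε a b : ℤ} (hε : ε = 1 ∨ ε = -1) (ha : 0 < ε * a) :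
    Int.sign (a * b) < 0 ↔ ε * b < 0 := by
  rw [← not_le, sign_mul_nonneg_iff hε ha, not_le]

theorem signPlus_mul {ε a b : ℤ} (hε : ε = 1 ∨ ε = -1) (ha : 0 < ε * a) :
    signPlus (a * b) = signPlus (ε * b) := by
  unfold signPlus
  simp only [← sign_mul_nonneg_iff hε ha, Int.sign_nonneg_iff]

theorem IsOptimal.rule4 (h : IsOptimal (2 * k + 1) n F) (hk : 2 ≤ k) :
    Rule4 k n (polynomialPart F).natDegree (coeffZ (polynomialPart F)) := by
  intro hn i hi1 him ε hε
  set m : ℤ := ((polynomialPart F).natDegree : ℤ) with hm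
  have hε' : -ε = 1 ∨ -ε = -1 := by omega
  have hF : ∀ s, 0 ≤ s → coeffZ (polynomialPart F) s = F.coeff s := fun s hs => by
    rw [coeffZ_polynomialPart, if_pos hs]
  intro hm1 htop hmid hlow
  rw [hF _ (by omega)] at hm1 htop hlow
  rw [hF m (by omega), potential_coeffZ _ _ (by omega)]
  -- For i = 1 the conditions on the first and last entries of the block contradict each other.
  have hi : 1 < i := by
    by_contra hi
    obtain rfl : i = 1 := by omega
    omega
  have hcm : F.coeff m = ε := by rcases hε with rfl | rfl <;> linarith
  have key := h.block_bounds (ε := -ε) (l := m - i) (j := m - 1) hε' (by omega) (by omega)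
    (by constructor <;> rcases htop with h | h <;> linarith)
    (by constructor <;> rcases hlow with h | h <;> linarith)
    (fun s h1 h2 => by
      have := hmid (m - s) (by omega) (by omega)
      rw [sub_sub_cancel, hF _ (by omega)] at this
      constructor <;> rcases this with h | h <;> linarith)
    (upperExponent_shiftBlock_drop _ (by omega) (by omega) (by omega) hn (by
      rw [sub_add_cancel, hcm, add_neg_cancel]))
  have hstep : absStep (-ε) (F.coeff m) = -1 := by
    rw [hcm]
    rcases hε with rfl | rfl <;> rfl
  rw [sub_add_cancel, hstep] at key
  constructor
  · intro hs
    rw [Int.sign_pos_iff, coeffZ_polynomialPart] at hs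
    split_ifs at hs with h0
    · have : -ε * F.coeff (m - i - 1) < 0 := by
        rw [hcm] at hs
        linarith
      linarith [key.2 this]
    · simp at hs
  -- The bound for a negative c_{l-1} is the stronger one, so this conclusion holds for either sign
  -- of the true coefficient.
  · intro _
    rcases le_or_gt 0 (-ε * F.coeff (m - i - 1)) with hs | hs
    · linarith [key.1 hs]
    · linarith [key.2 hs]

theorem IsOptimal.rule5 (h : IsOptimal (2 * k + 1) n F) (hk : 2 ≤ k) :
    Rule5 k n (polynomialPart F).natDegree (coeffZ (polynomialPart F)) := by
  intro hn i hi1 him ε hε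
  set m : ℤ := ((polynomialPart F).natDegree : ℤ) with hm
  have hF : ∀ s, 0 ≤ s → coeffZ (polynomialPart F) s = F.coeff s := fun s hs => by
    rw [coeffZ_polynomialPart, if_pos hs]
  intro htop hmid hlow
  rw [hF _ (by omega)] at htop hlow
  rw [hF m (by omega), potential_coeffZ _ _ (by omega)]
  -- The end coefficients must satisfy k + 2 ≤ 2k and k + 1 < 2k; this uses k ≥ 2.
  have key := h.block_bounds (ε := ε) (l := m - i) (j := m) hε (by omega) (by omega)
    (by constructor <;> rcases htop with h | h <;> linarith)
    (by constructor <;> rcases hlow with h | h <;> linarith)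
    (fun s h1 h2 => by
      have := hmid (m - s) (by omega) (by omega)
      rw [sub_sub_cancel, hF _ (by omega)] at this
      constructor <;> rcases this with h | h <;> linarith)
    (upperExponent_shiftBlock_top _ _ (by omega) hm)
  have hstep : absStep ε (F.coeff (m + 1)) = 1 := by
    rw [coeff_eq_zero_of_natDegree_lt (by omega), absStep_eq hε, mul_zero]
    rfl
  rw [hstep] at key
  have hpos : 0 < ε * F.coeff m := by rcases htop with h | h <;> linarith
  constructor
  · intro _
    rcases le_or_gt 0 (ε * F.coeff (m - i - 1)) with hs | hs
    · linarith [key.1 hs]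
    · linarith [key.2 hs]
  · intro hs
    have := mul_coeff_pred_neg hs
    rw [← Int.sign_neg_iff, sign_mul_neg_iff hε hpos] at this
    linarith [key.2 this]

theorem IsOptimal.rule6 (h : IsOptimal (2 * k + 1) n F) (hk : 2 ≤ k) :
    Rule6 k n (polynomialPart F).natDegree (coeffZ (polynomialPart F)) := by
  intro j l hl hlj hj ε hε
  have hF : ∀ s, 0 ≤ s → coeffZ (polynomialPart F) s = F.coeff s := fun s hs => by
    rw [coeffZ_polynomialPart, if_pos hs]
  intro htop hmid hlow
  rw [hF _ (by omega)] at htop hlow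
  rw [hF j (by omega), hF (j + 1) (by omega), potential_coeffZ _ _ hl]
  have key := h.block_bounds (ε := ε) (l := l) (j := j) hε hl hlj
    (by constructor <;> rcases htop with h | h <;> linarith)
    (by constructor <;> rcases hlow with h | h <;> linarith)
    (fun s h1 h2 => by
      have := hmid s h1 h2
      rw [hF _ (by omega)] at this
      constructor <;> rcases this with h | h <;> linarith)
    (upperExponent_shiftBlock_inner _ _ hlj.le (by omega))
  have hpos : 0 < ε * F.coeff j := by rcases htop with h | h <;> linarith
  rw [absStep_eq hε, ← signPlus_mul hε hpos] at key
  constructor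
  · intro _
    rcases le_or_gt 0 (ε * F.coeff (l - 1)) with hs | hs
    · linarith [key.1 hs]
    · linarith [key.2 hs]
  · intro hs
    have := mul_coeff_pred_neg hs
    rw [← Int.sign_neg_iff, sign_mul_neg_iff hε hpos] at this
    linarith [key.2 this]

theorem IsOptimal.isNReduced (h : IsOptimal (2 * k + 1) n F) (hk : 2 ≤ k) :
    IsNReduced k n (polynomialPart F) :=
  ⟨h.rule1 hk, h.rule2 hk, h.rule3 hk, h.rule4 hk, h.rule5 hk, h.rule6 hk⟩

theorem IsOptimal.isPrincipalNReduced (h : IsOptimal (2 * k + 1) n F) (hk : 2 ≤ k) :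
    IsPrincipalNReduced k n (principalPart F) := by
  rw [IsPrincipalNReduced, mirror_principalPart]
  exact h.reflect.isNReduced hk

/-! ### The action of the powers of `T` -/

/-- The vector `T ^ n x`. -/
def torusAct (d n : ℤ) (x : Fin 2 → ℤ) : Fin 2 → ℤ :=
  ((Matrix.SpecialLinearGroup.toGL (torusMatrix d) ^ n : GL (Fin 2) ℤ) :
    Matrix (Fin 2) (Fin 2) ℤ) *ᵥ x

theorem torusAct_zero_left (d : ℤ) (x : Fin 2 → ℤ) : torusAct d 0 x = x := by
  simp [torusAct]

theorem torusAct_torusAct (d m n : ℤ) (x : Fin 2 → ℤ) :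
    torusAct d m (torusAct d n x) = torusAct d (m + n) x := by
  simp only [torusAct, Matrix.mulVec_mulVec, zpow_add, Units.val_mul]

theorem torusAct_add (d n : ℤ) (x y : Fin 2 → ℤ) :
    torusAct d n (x + y) = torusAct d n x + torusAct d n y :=
  Matrix.mulVec_add _ _ _

theorem torusAct_smul (d n c : ℤ) (x : Fin 2 → ℤ) :
    torusAct d n (c • x) = c • torusAct d n x :=
  Matrix.mulVec_smul _ _ _

theorem torusAct_zero (d n : ℤ) : torusAct d n 0 = 0 :=
  Matrix.mulVec_zero _

theorem torusAct_sum {ι : Type*} (d n : ℤ) (s : Finset ι) (f : ι → Fin 2 → ℤ) :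
    torusAct d n (∑ i ∈ s, f i) = ∑ i ∈ s, torusAct d n (f i) :=
  Matrix.mulVec_sum _ _ _

theorem torusAct_one (d : ℤ) (x : Fin 2 → ℤ) : torusAct d 1 x = ![-x 1, x 0 + d * x 1] := by
  rw [torusAct, zpow_one]
  change !![0, -1; 1, d] *ᵥ x = _
  ext i
  fin_cases i <;> simp [Matrix.mulVec, dotProduct, Fin.sum_univ_two]

/-- Thus a and b correspond to the monomials X⁻¹ and 1, which explains the offset by one in p. -/
theorem torusAct_neg_one_b (d : ℤ) : torusAct d (-1) ![0, 1] = ![1, 0] := by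
  have h : torusAct d 1 ![1, 0] = ![0, 1] := by
    rw [torusAct_one]
    simp
  rw [← h, torusAct_torusAct, neg_add_cancel, torusAct_zero_left]

theorem torusAut_ofAdd (d : ℤ) (x : Fin 2 → ℤ) :
    torusAut d (Multiplicative.ofAdd x) = Multiplicative.ofAdd (torusAct d 1 x) := by
  simp only [torusAct, zpow_one]
  rfl

theorem torusAut_zpow_ofAdd (d n : ℤ) (x : Fin 2 → ℤ) :
    (torusAut d ^ n) (Multiplicative.ofAdd x) = Multiplicative.ofAdd (torusAct d n x) := by
  induction n generalizing x with
  | zero => rw [zpow_zero, torusAct_zero_left]; rfl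
  | succ n ih => rw [zpow_add_one, MulAut.mul_apply, torusAut_ofAdd, ih, torusAct_torusAct]
  | pred n ih =>
    have h : (torusAut d)⁻¹ (Multiplicative.ofAdd x) =
        Multiplicative.ofAdd (torusAct d (-1) x) := by
      rw [MulAut.inv_apply, MulEquiv.symm_apply_eq, torusAut_ofAdd, torusAct_torusAct,
        add_neg_cancel, torusAct_zero_left]
    rw [zpow_sub_one, MulAut.mul_apply, h, ih, torusAct_torusAct, ← sub_eq_add_neg]

theorem torusElt_mul (d : ℤ) (x y : Fin 2 → ℤ) (m n : ℤ) :
    torusElt d x m * torusElt d y n = torusElt d (x + torusAct d m y) (m + n) := by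
  refine SemidirectProduct.ext ?_ rfl
  rw [SemidirectProduct.mul_left]
  change Multiplicative.ofAdd x * (torusAut d ^ m) (Multiplicative.ofAdd y) = _
  rw [torusAut_zpow_ofAdd]
  rfl

theorem torusElt_zero_zero (d : ℤ) : torusElt d 0 0 = 1 := rfl

theorem torusElt_zero_right_inv (d : ℤ) (x : Fin 2 → ℤ) :
    (torusElt d x 0)⁻¹ = torusElt d (-x) 0 := by
  apply inv_eq_of_mul_eq_one_right
  rw [torusElt_mul, torusAct_zero_left, add_neg_cancel, add_zero, torusElt_zero_zero]

theorem torusElt_zero_left_inv (d n : ℤ) : (torusElt d 0 n)⁻¹ = torusElt d 0 (-n) := by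
  apply inv_eq_of_mul_eq_one_right
  rw [torusElt_mul, torusAct_zero, add_neg_cancel, add_zero, torusElt_zero_zero]

theorem torusElt_zero_right_zpow (d : ℤ) (x : Fin 2 → ℤ) (c : ℤ) :
    torusElt d x 0 ^ c = torusElt d (c • x) 0 := by
  change (SemidirectProduct.inl (Multiplicative.ofAdd x) : TorusBundleGroup d) ^ c = _
  rw [← map_zpow, ← ofAdd_zsmul]
  rfl

theorem torusElt_zero_left_zpow (d c : ℤ) : torusElt d 0 1 ^ c = torusElt d 0 c := by
  change (SemidirectProduct.inr (Multiplicative.ofAdd 1) : TorusBundleGroup d) ^ c = _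
  rw [← map_zpow, ← ofAdd_zsmul, smul_eq_mul, mul_one]
  rfl

/-! ### Evaluation of Laurent polynomials -/

/-- The vector `F(T)(b)`. -/
def evalVec (d : ℤ) (F : ℤ[T;T⁻¹]) : Fin 2 → ℤ :=
  (F.smeval (Matrix.SpecialLinearGroup.toGL (torusMatrix d)) : Matrix (Fin 2) (Fin 2) ℤ) *ᵥ ![0, 1]

theorem evalVec_add (d : ℤ) (F G : ℤ[T;T⁻¹]) :
    evalVec d (F + G) = evalVec d F + evalVec d G := by
  rw [evalVec, LaurentPolynomial.smeval_add, Matrix.add_mulVec]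
  rfl

theorem evalVec_C_mul_T (d r n : ℤ) : evalVec d (C r * T n) = r • torusAct d n ![0, 1] := by
  rw [evalVec, LaurentPolynomial.smeval_C_mul_T_n, Matrix.smul_mulVec]
  rfl

theorem evalVec_eq_sum (d : ℤ) {F : ℤ[T;T⁻¹]} {S : Finset ℤ} (h : F.coeff.support ⊆ S) :
    evalVec d F = ∑ j ∈ S, F.coeff j • torusAct d j ![0, 1] := by
  rw [evalVec, LaurentPolynomial.smeval_eq_sum, Finsupp.sum_of_support_subset _ h _ (by simp),
    Matrix.sum_mulVec]
  exact Finset.sum_congr rfl fun j _ => Matrix.smul_mulVec _ _ _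

theorem evalVec_T_mul (d i : ℤ) (F : ℤ[T;T⁻¹]) :
    evalVec d (T i * F) = torusAct d i (evalVec d F) := by
  induction F using LaurentPolynomial.induction_on' with
  | add F G hF hG => rw [mul_add, evalVec_add, evalVec_add, torusAct_add, hF, hG]
  | C_mul_T n a =>
    rw [mul_left_comm, ← LaurentPolynomial.T_add, evalVec_C_mul_T, evalVec_C_mul_T,
      torusAct_smul, torusAct_torusAct]

/-- This reduces to Tb + T⁻¹b = db. The converse, that all representatives of x differ by such
multiples, is not needed. -/
theorem evalVec_mul_charRel (d : ℤ) (A : ℤ[T;T⁻¹]) : evalVec d (A * charRel d) = 0 := by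
  induction A using LaurentPolynomial.induction_on' with
  | add F G hF hG => rw [add_mul, evalVec_add, hF, hG, add_zero]
  | C_mul_T n a =>
    have h : C a * T n * charRel d = T n * (C a * T 1 + C a * T (-1) + C (-(a * d)) * T 0) := by
      rw [charRel, map_neg, map_mul, LaurentPolynomial.T_zero]
      ring
    rw [h, evalVec_T_mul, evalVec_add, evalVec_add, evalVec_C_mul_T, evalVec_C_mul_T,
      evalVec_C_mul_T, torusAct_neg_one_b, torusAct_one, torusAct_zero_left]
    convert torusAct_zero d n using 2
    ext i
    fin_cases i <;> simp

/-! ### Words represent Laurent polynomials of small length -/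

theorem coeffNorm_T_mul_le (i : ℤ) (F : ℤ[T;T⁻¹]) : coeffNorm (T i * F) ≤ coeffNorm F := by
  classical
  rw [coeffNorm_eq_sum (F := T i * F) (S := F.coeff.support.image fun j => j + i)]
  · rw [Finset.sum_image (by intro a _ b _ h; simpa using h)]
    refine le_of_eq (Finset.sum_congr rfl fun j _ => ?_)
    rw [coeff_T_mul, add_sub_cancel_right]
  · intro j hj
    rw [Finsupp.mem_support_iff, coeff_T_mul] at hj
    exact Finset.mem_image.2 ⟨j - i, by simpa using hj, by ring⟩

/-- q rises by at most one. If n ≥ 0, then |n| rises by one; if n < 0, then p ≥ 1 and both p and |n|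
fall by one. The net cost is at most one either way. -/
theorem nLength_T_mul_le (n : ℤ) (F : ℤ[T;T⁻¹]) :
    nLength (n + 1) (T 1 * F) ≤ nLength n F + 1 := by
  have h1 := coeffNorm_T_mul_le 1 F
  have h2 : (upperExponent (n + 1) (T 1 * F) : ℤ) ≤ upperExponent n F + 1 := by
    refine (upperExponent_le_iff (by positivity)).2 ⟨?_, fun j hj => ?_⟩
    · linarith [self_le_upperExponent n F]
    · rw [coeff_T_mul] at hj
      linarith [le_upperExponent (n := n) hj]
  have h3 : (lowerExponent (n + 1) (T 1 * F) : ℤ) ≤ max 0 ((lowerExponent n F : ℤ) - 1) := by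
    refine (lowerExponent_le_iff (le_max_left _ _)).2 ⟨?_, fun j hj => ?_⟩
    · have := neg_le_lowerExponent n F
      omega
    · rw [coeff_T_mul] at hj
      have := le_lowerExponent (n := n) hj
      omega
  have h4 := neg_le_lowerExponent n F
  rw [nLength_eq, nLength_eq]
  rcases abs_cases n with h | h <;> rcases abs_cases (n + 1) with h' | h' <;> omega

theorem nLength_T_neg_mul_le (n : ℤ) (F : ℤ[T;T⁻¹]) :
    nLength (n + -1) (T (-1) * F) ≤ nLength n F + 1 := by
  have h : reflect (T (-1) * F) = T 1 * reflect F := by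
    rw [reflect, reflect, map_mul, LaurentPolynomial.invert_T, neg_neg]
    ring
  rw [← nLength_reflect, h, ← nLength_reflect n F, neg_add, neg_neg]
  exact nLength_T_mul_le _ _

theorem nLength_add_monomial_le (n : ℤ) (F : ℤ[T;T⁻¹]) {ε i : ℤ} (hε : |ε| ≤ 1)
    (hi : i = 0 ∨ i = -1) : nLength n (F + C ε * T i) ≤ nLength n F + 1 := by
  have hc : ∀ j, (F + C ε * T i).coeff j = F.coeff j + if i = j then ε else 0 := fun j => by
    rw [AddMonoidAlgebra.coeff_add, Finsupp.add_apply, coeff_C_mul, LaurentPolynomial.T_apply]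
    simp
  have hne : ∀ j, (F + C ε * T i).coeff j ≠ 0 → F.coeff j ≠ 0 ∨ j = i := fun j hj => by
    rw [hc] at hj
    grind
  have h1 : coeffNorm (F + C ε * T i) - coeffNorm F ≤ 1 := by
    rw [coeffNorm_sub_coeffNorm (S := {i})]
    · rw [Finset.sum_singleton, hc, if_pos rfl]
      linarith [abs_add_le (F.coeff i) ε]
    · intro j hj
      rw [hc, if_neg (by simpa [eq_comm] using hj), add_zero]
  have h2 : (upperExponent n (F + C ε * T i) : ℤ) ≤ upperExponent n F := by
    refine (upperExponent_le_iff (by positivity)).2 ⟨self_le_upperExponent n F, fun j hj => ?_⟩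
    rcases hne j hj with h | h
    · exact le_upperExponent h
    · omega
  have h3 : (lowerExponent n (F + C ε * T i) : ℤ) ≤ lowerExponent n F := by
    refine (lowerExponent_le_iff (by positivity)).2 ⟨neg_le_lowerExponent n F, fun j hj => ?_⟩
    rcases hne j hj with h | h
    · exact le_lowerExponent h
    · omega
  rw [nLength_eq, nLength_eq]
  linarith

theorem generator_or_inv {d : ℤ} {s : TorusBundleGroup d}
    (hs : s ∈ torusGenerators d ∨ s⁻¹ ∈ torusGenerators d) :
    (∃ ε i : ℤ, |ε| ≤ 1 ∧ (i = 0 ∨ i = -1) ∧ s = torusElt d (ε • torusAct d i ![0, 1]) 0) ∨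
      s = torusElt d 0 1 ∨ s = torusElt d 0 (-1) := by
  simp only [torusGenerators, Set.mem_insert_iff, Set.mem_singleton_iff] at hs
  rcases hs with (h | h | h) | (h | h | h)
  · exact Or.inl ⟨1, -1, by simp, Or.inr rfl, by rw [h, torusAct_neg_one_b, one_smul]⟩
  · exact Or.inl ⟨1, 0, by simp, Or.inl rfl, by rw [h, torusAct_zero_left, one_smul]⟩
  · exact Or.inr (Or.inl h)
  · refine Or.inl ⟨-1, -1, by simp, Or.inr rfl, ?_⟩
    rw [inv_eq_iff_eq_inv.1 h, torusElt_zero_right_inv, torusAct_neg_one_b, neg_one_smul]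
  · refine Or.inl ⟨-1, 0, by simp, Or.inl rfl, ?_⟩
    rw [inv_eq_iff_eq_inv.1 h, torusElt_zero_right_inv, torusAct_zero_left, neg_one_smul]
  · exact Or.inr (Or.inr (by rw [inv_eq_iff_eq_inv.1 h, torusElt_zero_left_inv]))

/-- Prepending t^{±1} multiplies F by X^{±1}; prepending a^{±1} or b^{±1} adds ±X⁻¹ or ±1. -/
theorem exists_nLength_le_of_word {d : ℤ} (w : List (TorusBundleGroup d))
    (hw : ∀ s ∈ w, s ∈ torusGenerators d ∨ s⁻¹ ∈ torusGenerators d) :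
    ∃ (F : ℤ[T;T⁻¹]) (n : ℤ), w.prod = torusElt d (evalVec d F) n ∧ nLength n F ≤ w.length := by
  induction w with
  | nil => exact ⟨0, 0, by simp [evalVec, torusElt_zero_zero],
      by simp [nLength, upperExponent, lowerExponent]⟩
  | cons s w ih =>
    obtain ⟨F, n, hF, hn⟩ := ih fun s hs => hw s (List.mem_cons_of_mem _ hs)
    rw [List.prod_cons, hF, List.length_cons, Nat.cast_add, Nat.cast_one]
    rcases generator_or_inv (hw s List.mem_cons_self) with ⟨ε, i, hε, hi, rfl⟩ | rfl | rfl
    · refine ⟨F + C ε * T i, n, ?_, (nLength_add_monomial_le n F hε hi).trans (by linarith)⟩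
      rw [torusElt_mul, torusAct_zero_left, evalVec_add, evalVec_C_mul_T, zero_add, add_comm]
    · refine ⟨T 1 * F, n + 1, ?_, (nLength_T_mul_le n F).trans (by linarith)⟩
      rw [torusElt_mul, evalVec_T_mul, zero_add, add_comm 1]
    · refine ⟨T (-1) * F, n + -1, ?_, (nLength_T_neg_mul_le n F).trans (by linarith)⟩
      rw [torusElt_mul, evalVec_T_mul, zero_add, add_comm (-1)]

/-! ### Laurent polynomials give words -/

/-- The element `g` is the value of a word of length `r` in `S` and inverses. -/
def HasWord {G : Type*} [Group G] (S : Set G) (g : G) (r : ℕ) : Prop :=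
  ∃ w : List G, (∀ s ∈ w, s ∈ S ∨ s⁻¹ ∈ S) ∧ w.prod = g ∧ w.length = r

section HasWord

variable {G : Type*} [Group G] {S : Set G}

theorem HasWord.mul {g h : G} {r s : ℕ} (hg : HasWord S g r) (hh : HasWord S h s) :
    HasWord S (g * h) (r + s) := by
  obtain ⟨w, hw, rfl, rfl⟩ := hg
  obtain ⟨v, hv, rfl, rfl⟩ := hh
  refine ⟨w ++ v, fun s hs => ?_, List.prod_append, List.length_append⟩
  exact (List.mem_append.1 hs).elim (hw s) (hv s)

theorem hasWord_zpow {s : G} (hs : s ∈ S) (c : ℤ) : HasWord S (s ^ c) c.natAbs := by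
  rcases Int.eq_nat_or_neg c with ⟨m, rfl | rfl⟩
  · refine ⟨List.replicate m s, fun u hu => Or.inl ?_, by simp, by simp⟩
    rwa [List.eq_of_mem_replicate hu]
  · refine ⟨List.replicate m s⁻¹, fun u hu => Or.inr ?_, by simp, by simp⟩
    rwa [List.eq_of_mem_replicate hu, inv_inv]

end HasWord

theorem hasWord_a (d c : ℤ) :
    HasWord (torusGenerators d) (torusElt d (c • torusAct d (-1) ![0, 1]) 0) c.natAbs := by
  rw [torusAct_neg_one_b, ← torusElt_zero_right_zpow]
  exact hasWord_zpow (by simp [torusGenerators]) c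

theorem hasWord_b (d c : ℤ) :
    HasWord (torusGenerators d) (torusElt d (c • ![0, 1]) 0) c.natAbs := by
  rw [← torusElt_zero_right_zpow]
  exact hasWord_zpow (by simp [torusGenerators]) c

theorem hasWord_t (d c : ℤ) : HasWord (torusGenerators d) (torusElt d 0 c) c.natAbs := by
  rw [← torusElt_zero_left_zpow]
  exact hasWord_zpow (by simp [torusGenerators]) c

theorem hasWord_sweep (d : ℤ) {ε : ℤ} (hε : ε.natAbs = 1) (c : ℕ → ℤ) (N : ℕ) :
    HasWord (torusGenerators d)
      (torusElt d (∑ i ∈ Finset.range (N + 1), c i • torusAct d (ε * i) ![0, 1]) (ε * N))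
      (N + ∑ i ∈ Finset.range (N + 1), (c i).natAbs) := by
  induction N with
  | zero =>
    have h := hasWord_b d (c 0)
    rwa [zero_add, Finset.sum_range_one, Finset.sum_range_one, Nat.cast_zero, mul_zero,
      torusAct_zero_left, zero_add]
  | succ N ih =>
    have h := (ih.mul (hasWord_t d ε)).mul (hasWord_b d (c (N + 1)))
    rw [torusElt_mul, torusElt_mul, torusAct_zero, torusAct_smul, add_zero, add_zero, hε] at h
    rw [Finset.sum_range_succ _ (N + 1), Finset.sum_range_succ _ (N + 1)]
    convert h using 1
    · congr 1
      · congr 3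
        push_cast
        ring
      · push_cast
        ring
    · ring

theorem sum_Icc_eq_up {M : Type*} [AddCommMonoid M] (f : ℤ → M) (p q : ℕ) :
    ∑ j ∈ Finset.Icc (-(p : ℤ) - 1) q, f j =
      f (-p - 1) + ∑ i ∈ Finset.range (p + q + 1), f (-p + i) := by
  classical
  have hS : Finset.Icc (-(p : ℤ) - 1) q =
      insert (-(p : ℤ) - 1) ((Finset.range (p + q + 1)).image fun i : ℕ => -(p : ℤ) + i) := by
    ext j
    simp only [Finset.mem_Icc, Finset.mem_insert, Finset.mem_image, Finset.mem_range]
    refine ⟨fun h => ?_, ?_⟩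
    · rcases eq_or_lt_of_le h.1 with h' | h'
      · exact Or.inl h'.symm
      · exact Or.inr ⟨(j + p).toNat, by omega, by omega⟩
    · rintro (rfl | ⟨i, hi, rfl⟩) <;> omega
  rw [hS, Finset.sum_insert, Finset.sum_image (by intro a _ b _ h; simpa using h)]
  simp only [Finset.mem_image, Finset.mem_range, not_exists, not_and]
  intro i _
  omega

theorem sum_Icc_eq_down {M : Type*} [AddCommMonoid M] (f : ℤ → M) (p q : ℕ) :
    ∑ j ∈ Finset.Icc (-(p : ℤ) - 1) q, f j =
      ∑ i ∈ Finset.range (p + q + 1), f (q - i) + f (-p - 1) := by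
  rw [sum_Icc_eq_up, add_comm, ← Finset.sum_range_reflect]
  congr 1
  refine Finset.sum_congr rfl fun i hi => ?_
  rw [Finset.mem_range] at hi
  congr 1
  omega

/-- For n ≥ 0, go down to -p, use a for exponent -p - 1, sweep up to q with b, and return to n: p +
(p + q) + (q - n) letters t^{±1}. For n ≤ 0, go up to q, sweep down, then use a at -p: q + (p + q) +
(n + p). -/
theorem hasWord_of_nLength (d n : ℤ) (F : ℤ[T;T⁻¹]) :
    HasWord (torusGenerators d) (torusElt d (evalVec d F) n) (nLength n F).toNat := by
  set p := lowerExponent n F with hp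
  set q := upperExponent n F with hq
  have hsupp : F.coeff.support ⊆ Finset.Icc (-(p : ℤ) - 1) q := fun j hj => by
    rw [Finsupp.mem_support_iff] at hj
    have h1 := le_upperExponent (n := n) hj
    have h2 := le_lowerExponent (n := n) hj
    rw [Finset.mem_Icc]
    omega
  have hqn := self_le_upperExponent n F
  have hpn := neg_le_lowerExponent n F
  rcases le_total 0 n with hn | hn
  · have h := (((hasWord_t d (-p)).mul (hasWord_a d (F.coeff (-p - 1)))).mul
      (hasWord_sweep d (ε := 1) rfl (fun i => F.coeff (-p + i)) (p + q))).mul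
      (hasWord_t d (n - q))
    convert h using 1
    · rw [torusElt_mul, torusElt_mul, torusElt_mul, torusAct_zero, evalVec_eq_sum d hsupp,
        sum_Icc_eq_up]
      congr 1
      · simp only [torusAct_smul, torusAct_sum, torusAct_torusAct, zero_add, add_zero, one_mul]
        rfl
      · push_cast
        ring
    · zify
      rw [nLength_eq, coeffNorm_eq_sum hsupp, sum_Icc_eq_up, ← hp, ← hq, abs_of_nonneg hn,
        abs_of_nonpos (show n - q ≤ 0 by omega), Int.toNat_of_nonneg]
      · simp
        ring
      · have : 0 ≤ ∑ i ∈ Finset.range (p + q + 1), |F.coeff (-p + i)| :=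
          Finset.sum_nonneg fun _ _ => abs_nonneg _
        have := abs_nonneg (F.coeff (-(p : ℤ) - 1))
        omega
  · have h := (((hasWord_t d q).mul
      (hasWord_sweep d (ε := -1) rfl (fun i => F.coeff (q - i)) (p + q))).mul
      (hasWord_a d (F.coeff (-p - 1)))).mul (hasWord_t d (n + p))
    convert h using 1
    · rw [torusElt_mul, torusElt_mul, torusElt_mul, torusAct_zero, evalVec_eq_sum d hsupp,
        sum_Icc_eq_down]
      congr 1
      · simp only [torusAct_smul, torusAct_sum, torusAct_torusAct, zero_add, add_zero]
        congr 1
        · refine Finset.sum_congr rfl fun i _ => ?_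
          congr 2
          ring
        · congr 2
          push_cast
          ring
      · push_cast
        ring
    · zify
      rw [nLength_eq, coeffNorm_eq_sum hsupp, sum_Icc_eq_down, ← hp, ← hq, abs_of_nonpos hn,
        abs_of_nonneg (show 0 ≤ n + p by omega), Int.toNat_of_nonneg]
      · simp
        ring
      · have : 0 ≤ ∑ i ∈ Finset.range (p + q + 1), |F.coeff (q - i)| :=
          Finset.sum_nonneg fun _ _ => abs_nonneg _
        have := abs_nonneg (F.coeff (-(p : ℤ) - 1))
        omega

theorem nLength_nonneg (n : ℤ) (F : ℤ[T;T⁻¹]) : 0 ≤ nLength n F := by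
  have h1 := self_le_upperExponent n F
  have h2 := neg_le_lowerExponent n F
  have h3 : 0 ≤ coeffNorm F := Finset.sum_nonneg fun _ _ => abs_nonneg _
  rw [nLength_eq]
  rcases abs_cases n with h | h <;> omega

theorem wordLength_le_nLength (d n : ℤ) (F : ℤ[T;T⁻¹]) :
    (wordLength (torusGenerators d) (torusElt d (evalVec d F) n) : ℤ) ≤ nLength n F := by
  rw [← Int.toNat_of_nonneg (nLength_nonneg n F), Nat.cast_le]
  exact Nat.sInf_le (hasWord_of_nLength d n F)

theorem exists_evalVec_eq (d : ℤ) (x : Fin 2 → ℤ) : ∃ F : ℤ[T;T⁻¹], evalVec d F = x := by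
  refine ⟨C (x 0) * T (-1) + C (x 1) * T 0, ?_⟩
  rw [evalVec_add, evalVec_C_mul_T, evalVec_C_mul_T, torusAct_neg_one_b, torusAct_zero_left]
  ext i
  fin_cases i <;> simp

theorem exists_isMinimalRepresentative (d n : ℤ) (x : Fin 2 → ℤ) :
    ∃ F : ℤ[T;T⁻¹], IsMinimalRepresentative d n x F := by
  obtain ⟨F₀, hF₀⟩ := exists_evalVec_eq d x
  have hne : {r : ℕ | HasWord (torusGenerators d) (torusElt d x n) r}.Nonempty :=
    ⟨_, hF₀ ▸ hasWord_of_nLength d n F₀⟩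
  obtain ⟨w, hw, hprod, hlen⟩ := Nat.sInf_mem hne
  obtain ⟨F, m, hF, hm⟩ := exists_nLength_le_of_word w hw
  rw [hprod] at hF
  have hx : x = evalVec d F :=
    congrArg (fun g : TorusBundleGroup d => Multiplicative.toAdd g.left) hF
  have hnm : n = m := congrArg (fun g : TorusBundleGroup d => Multiplicative.toAdd g.right) hF
  subst hnm
  refine ⟨F, hx, le_antisymm ?_ ?_⟩
  · rw [hlen] at hm
    exact hm
  · rw [hx]
    exact wordLength_le_nLength d n F

/-- The quantities p, q and all |c_j| are bounded by L + |n|. -/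
theorem finite_setOf_nLength_le (n L : ℤ) : {F : ℤ[T;T⁻¹] | nLength n F ≤ L}.Finite := by
  set B : ℤ := L + |n| with hB
  refine (((Finset.Icc (-B - 1) B).finsupp fun _ => Finset.Icc (-B) B).finite_toSet.preimage
    AddMonoidAlgebra.coeff_injective.injOn).subset fun F hF => ?_
  rw [Set.mem_ofPred_eq, nLength_eq] at hF
  have h3 : 0 ≤ coeffNorm F := Finset.sum_nonneg fun _ _ => abs_nonneg _
  rw [Set.mem_preimage, Finset.mem_coe, Finset.mem_finsupp_iff]
  refine ⟨fun j hj => ?_, fun j _ => ?_⟩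
  · rw [Finsupp.mem_support_iff] at hj
    have h1 := le_upperExponent (n := n) hj
    have h2 := le_lowerExponent (n := n) hj
    rw [Finset.mem_Icc]
    omega
  · rw [Finset.mem_Icc, ← abs_le]
    by_cases hj : j ∈ F.coeff.support
    · have : |F.coeff j| ≤ coeffNorm F :=
        Finset.single_le_sum (f := fun j => |F.coeff j|) (fun _ _ => abs_nonneg _) hj
      omega
    · rw [Finsupp.notMem_support_iff.1 hj, abs_zero]
      omega

theorem exists_isOptimal (d n : ℤ) (x : Fin 2 → ℤ) :
    ∃ F : ℤ[T;T⁻¹], IsMinimalRepresentative d n x F ∧ IsOptimal d n F := by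
  have hfin : {F | IsMinimalRepresentative d n x F}.Finite :=
    (finite_setOf_nLength_le n (wordLength (torusGenerators d) (torusElt d x n))).subset
      fun F hF => hF.2.le
  obtain ⟨F, hF, hmax⟩ := hfin.exists_maximalFor tieKey _ (exists_isMinimalRepresentative d n x)
  have hx : x = evalVec d F := hF.1
  have hrep : ∀ A, x = evalVec d (F + A * charRel d) := fun A => by
    rw [evalVec_add, evalVec_mul_charRel, add_zero, ← hx]
  refine ⟨F, hF, fun A => ?_, fun A hA hlt => ?_⟩
  · rw [hF.2, hrep A]
    exact wordLength_le_nLength d n _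
  · exact hlt.not_ge (hmax ⟨hrep A, hA.trans hF.2⟩ hlt.le)

theorem mainTheorem2 (k : ℤ) (hk : 5 ≤ 2 * k + 1) (x : Fin 2 → ℤ) (n : ℤ) :
    ∃ F : LaurentPolynomial ℤ,
      IsMinimalRepresentative (2 * k + 1) n x F ∧
      IsNReduced k n (polynomialPart F) ∧
      IsPrincipalNReduced k n (principalPart F) := by
  obtain ⟨F, hF, hopt⟩ := exists_isOptimal (2 * k + 1) n x
  exact ⟨F, hF, hopt.isNReduced (by omega), hopt.isPrincipalNReduced (by omega)⟩
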